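/- For $x\in\mathbb R$ let $\exp_0x=x$, $\exp_{n+1}x=\exp(\exp_nx)$, and for large $x$ let $\log_0x=x$, $\log_{n+1}x=\log(\log_nx)$. For a meromorphic function $f$ on $\mathbb C$ with Nevanlinna characteristic $T(r,f)$, the $(p,q)$-order is $$\rho_f(p,q)=\limsup_{r\to\infty}\frac{\log_pT(r,f)}{\log_qr}\in[0,\infty].$$ For $S\subset[0,\infty)$ the upper logarithmic density is $\overline{\log\mathrm{dens}}\,S=\limsup_{r\to\infty}\frac1{\log r}\int_{S\cap[1,r]}\frac{dt}{t}$. Let $p,q$ be integers with $p=q=1$ or $p\ge q\ge2$, and let $\rho>0$. There is a function $\delta_0:[0,\infty]\to(0,\infty)$, depending only on $p,q,\rho$, such that the following holds. Let $k\ge0$, let $c_0=0$, let $c_1,\dots,c_k$ be distinct nonzero complex numbers, and let $A_0,\dots,A_k$ be entire functions with $\max_{0\le j\le k}\rho_{A_j}(p,q)\le\rho$. Let $D\subset\mathbb C$ satisfy $\overline{\log\mathrm{dens}}\{|z|:z\in D\}>0$, and suppose that for some $l\in\{0,\dots,k\}$, some constants $0\le b<a$ and some $\delta$ with $0<\delta<\rho$,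 $$|A_l(z)|\ge\exp_p\!\big[a(\log_{q-1}|z|)^{\rho-\delta}\big],\qquad |A_j(z)|\le\exp_p\!\big[b(\log_{q-1}|z|)^{\rho-\delta}\big]\quad(0\le j\le k,\ j\ne l)$$ for all $z\in D$ with $|z|$ sufficiently large. Then every meromorphic solution $f\not\equiv0$ of $$A_k(z)f(z+c_k)+\dots+A_1(z)f(z+c_1)+A_0(z)f(z)=0$$ for which $\delta$ is sufficiently small, namely $\delta<\delta_0(\rho_f(p,q))$, satisfies (i) $\rho_f(1,1)\ge\rho_{A_l}(1,1)+1$ if $p=q=1$; (ii) $\rho_f(p,q)\ge\rho_{A_l}(p,q)$ if $p\ge q\ge2$. In particular, if the hypotheses hold for arbitrarily small $\delta>0$ (with $D$, $a$, $b$ possibly depending on $\delta$), then (i) and (ii) hold for every meromorphic solution $f\not\equiv0$. -/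

import Mathlib

open Filter Topology MeasureTheory

/-- The iterated exponential `exp_p`, with `exp_0 x = x`. -/
noncomputable def iterExp (p : ℕ) (x : ℝ) : ℝ := Real.exp^[p] x

/-- The iterated logarithm `log_p`, with `log_0 x = x`; only used for large arguments. -/
noncomputable def iterLog (p : ℕ) (x : ℝ) : ℝ := Real.log^[p] x

/-- The `(p,q)`-order `limsup_{r → ∞} log_p T(r,f) / log_q r` of a meromorphic function on the
plane, where `T(r,f)` is the Nevanlinna characteristic (for the value `∞`). The value is taken in
the extended reals; rational functions get order `0` by the same formula when `p ≥ q ≥ 1`. -/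
noncomputable def pqOrder (p q : ℕ) (f : ℂ → ℂ) : EReal :=
  limsup (fun r : ℝ =>
    ((iterLog p (ValueDistribution.characteristic f ⊤ r) / iterLog q r : ℝ) : EReal)) atTop

/-- The logarithmic measure `∫_{S ∩ [1,∞)} dt / t`. -/
noncomputable def logMeasure (S : Set ℝ) : ENNReal :=
  ∫⁻ t in S ∩ Set.Ici 1, ENNReal.ofReal t⁻¹

/-- The upper logarithmic density `limsup_{r → ∞} lm (S ∩ [1,r]) / log r`. -/
noncomputable def upperLogDensity (S : Set ℝ) : ENNReal :=
  limsup (fun r : ℝ => logMeasure (S ∩ Set.Icc 1 r) / ENNReal.ofReal (Real.log r)) atTop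

/-- `f` satisfies `∑ j, A j (z) * f (z + c j) = 0` as an identity of meromorphic functions, that is,
off a closed discrete subset of the plane (values at poles carry no meaning). -/
def IsDifferenceSolution {k : ℕ} (A : Fin (k + 1) → ℂ → ℂ) (c : Fin (k + 1) → ℂ)
    (f : ℂ → ℂ) : Prop :=
  Meromorphic f ∧ (fun z => ∑ j, A j z * f (z + c j)) =ᶠ[codiscrete ℂ] 0

/-- The growth condition at infinity along `D`: one coefficient `A l` is bounded below by
`exp_p (a (log_{q-1} |z|)^s)`, all others are bounded above by `exp_p (b (log_{q-1} |z|)^s)`. -/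
def DominantOn {k : ℕ} (p q : ℕ) (A : Fin (k + 1) → ℂ → ℂ) (l : Fin (k + 1)) (D : Set ℂ)
    (a b s : ℝ) : Prop :=
  ∀ᶠ z in Bornology.cobounded ℂ ⊓ 𝓟 D,
    iterExp p (a * iterLog (q - 1) ‖z‖ ^ s) ≤ ‖A l z‖ ∧
      ∀ j, j ≠ l → ‖A j z‖ ≤ iterExp p (b * iterLog (q - 1) ‖z‖ ^ s)

/-! If the order of f falls short, then T(r,f) ≤ exp_{p-1}((log_{q-1} r)^t) for large r, with some t
< ρ + 1 when p = q = 1 and some t < ρ when p ≥ q ≥ 2, because ρ_{A_l} ≤ ρ. Dividing the equation by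
f(z + c_l) bounds |A_l| by the sum over j ≠ l of |A_j| |f(z + c_j)/f(z + c_l)|. On D this is absurd
once the shift quotients are small against exp_p(a (log_{q-1}|z|)^{ρ-δ}); see
`not_dominantOn_of_pqOrder_lt`.

The tool is `Meromorphic.exists_logMeasure_lt_top_log_norm_shift_le`: for 0 < θ < 1, log|f(z +
c_i)/f(z + c_j)| ≤ Y |z|^{-θ} whenever Y ≥ 1 bounds T on [|z|, 16|z|], for |z| off a set of finite
logarithmic measure. Such a set cannot cover the moduli of D. For p = q = 1 the gain |z|^{-θ}, with
θ near 1, is the extra 1 in (i); for p ≥ 2 it is negligible.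

That estimate comes from Poisson–Jensen on a disk of radius R comparable to |z|. The harmonic part
of log|f| changes by O(T log R / R) under a bounded shift. A zero or pole u contributes potentials
||z| - |u - c_i||^{-β} with θ < β < 1. These are integrable in |z|, so Markov's inequality on [2^m,
2^{m+1}] leaves a bad set of logarithmic measure O(2^{m(θ-β)}), which is summable. -/

theorem countable_compl_of_mem_codiscrete {X : Type*} [TopologicalSpace X]
    [SecondCountableTopology X] {s : Set X} (hs : s ∈ codiscrete X) : sᶜ.Countable := by
  have h := (mem_codiscrete'.1 hs).2
  rw [isDiscrete_iff_discreteTopology] at h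
  exact Set.countable_coe_iff.1 (TopologicalSpace.separableSpace_iff_countable.1 inferInstance)

/-! ### Poisson–Jensen: oscillation of log|f| in a disk -/

open Metric Real Complex in
/-- A Lipschitz estimate for harmonic functions in terms of the mean of their modulus over a
larger circle. -/
theorem abs_sub_le_circleAverage_abs_of_harmonic {h : ℂ → ℝ} {R : ℝ} (hR : 0 < R)
    (hh : InnerProductSpace.HarmonicOnNhd h (closedBall 0 R)) {w₁ w₂ : ℂ}
    (h₁ : ‖w₁‖ ≤ R / 2) (h₂ : ‖w₂‖ ≤ R / 2) :
    |h w₁ - h w₂| ≤ 8 * ‖w₁ - w₂‖ / R * circleAverage (fun z ↦ |h z|) 0 R := by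
  have hb : ∀ w : ℂ, ‖w‖ ≤ R / 2 → w ∈ ball (0 : ℂ) R := fun w hw ↦ by
    rw [mem_ball_zero_iff]; linarith
  have hc : CircleIntegrable h 0 R :=
    (hh.continuousOn.mono sphere_subset_closedBall).circleIntegrable hR.le
  have hi : ∀ w : ℂ, ‖w‖ ≤ R / 2 →
      CircleIntegrable ((re ∘ herglotzRieszKernel 0 w) • h) 0 R := fun w hw ↦ by
    have := (continuous_re.comp_continuousOn (continuousOn_herglotzRieszKernel_sphere (hb w hw)))
    rw [abs_of_pos hR] at this
    exact (this.smul (hh.continuousOn.mono sphere_subset_closedBall)).circleIntegrable hR.le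
  rw [← hh.circleAverage_re_herglotzRieszKernel_smul (hb w₁ h₁),
    ← hh.circleAverage_re_herglotzRieszKernel_smul (hb w₂ h₂),
    ← circleAverage_sub (hi w₁ h₁) (hi w₂ h₂)]
  refine abs_circleAverage_le_circleAverage_abs.trans ?_
  rw [← smul_eq_mul, ← circleAverage_fun_smul]
  refine circleAverage_mono ((hi w₁ h₁).sub (hi w₂ h₂)).abs hc.abs.const_smul ?_
  intro z hz
  have hz' : ‖z‖ = R := by simpa [abs_of_pos hR] using hz
  have hd : ∀ w : ℂ, ‖w‖ ≤ R / 2 → R / 2 ≤ ‖z - w‖ := fun w hw ↦ by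
    have := norm_sub_norm_le z w
    linarith
  have hne : ∀ w : ℂ, ‖w‖ ≤ R / 2 → z - w ≠ 0 := fun w hw h0 ↦ by
    have := hd w hw
    rw [h0, norm_zero] at this
    linarith
  have hk : herglotzRieszKernel 0 w₁ z - herglotzRieszKernel 0 w₂ z
      = 2 * z * (w₁ - w₂) / ((z - w₁) * (z - w₂)) := by
    have e1 := hne w₁ h₁
    have e2 := hne w₂ h₂
    simp only [herglotzRieszKernel_def, sub_zero]
    field_simp
    ring
  have hkn : ‖herglotzRieszKernel 0 w₁ z - herglotzRieszKernel 0 w₂ z‖ ≤ 8 * ‖w₁ - w₂‖ / R := by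
    rw [hk, norm_div, norm_mul, norm_mul, norm_mul, hz']
    calc ‖(2 : ℂ)‖ * R * ‖w₁ - w₂‖ / (‖z - w₁‖ * ‖z - w₂‖)
        ≤ ‖(2 : ℂ)‖ * R * ‖w₁ - w₂‖ / (R / 2 * (R / 2)) := by
          gcongr
          · exact hd w₁ h₁
          · exact hd w₂ h₂
      _ = 8 * ‖w₁ - w₂‖ / R := by
          rw [Complex.norm_ofNat]
          field_simp
          ring
  change |(herglotzRieszKernel 0 w₁ z).re * h z - (herglotzRieszKernel 0 w₂ z).re * h z|
    ≤ 8 * ‖w₁ - w₂‖ / R * |h z|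
  rw [← sub_mul, abs_mul, ← sub_re]
  gcongr
  exact (abs_re_le_norm _).trans hkn

open Metric Real in
-- |x| + x is twice the positive part of x, hence at most 2 log(2R) here, and by Jensen's formula
-- the mean of log|z - u| is log R ≥ 0.
theorem circleAverage_abs_log_norm_sub_le {u : ℂ} {R : ℝ} (hR : 1 ≤ R) (hu : ‖u‖ ≤ R) :
    circleAverage (fun z ↦ |log ‖z - u‖|) 0 R ≤ 2 * log (2 * R) := by
  have hR0 : 0 < R := by linarith
  have i1 : CircleIntegrable (fun z ↦ log ‖z - u‖) 0 R := circleIntegrable_log_norm_sub_const R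
  have i2 : CircleIntegrable (fun z ↦ |log ‖z - u‖|) 0 R := i1.abs
  have hle : circleAverage (fun z ↦ |log ‖z - u‖| + log ‖z - u‖) 0 R ≤ 2 * log (2 * R) := by
    refine circleAverage_mono_on_of_le_circle (i2.add i1) fun z hz ↦ ?_
    have hz' : ‖z‖ = R := by simpa [abs_of_pos hR0] using hz
    have h2 : ‖z - u‖ ≤ 2 * R := (norm_sub_le z u).trans (by linarith)
    have h3 : 0 ≤ log (2 * R) := log_nonneg (by linarith)
    rcases le_total (log ‖z - u‖) 0 with h | h
    · rw [abs_of_nonpos h]; linarith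
    · rw [abs_of_nonneg h]
      rcases (norm_nonneg (z - u)).eq_or_lt with h0 | h0
      · rw [← h0, log_zero]; linarith
      · have := log_le_log h0 h2
        linarith
  rw [circleAverage_fun_add i2 i1, circleAverage_log_norm_sub_const_of_mem_closedBall
    (by simpa [abs_of_pos hR0] using hu)] at hle
  have := log_nonneg hR
  linarith

open Metric Real ValueDistribution MeromorphicOn in
/-- A quantitative form of the Poisson–Jensen formula: the oscillation of `log ‖f‖` inside the disk
of radius `R / 2` is controlled by the zeros and poles and by the proximity functions. -/
theorem Meromorphic.log_norm_sub_log_norm_le {f : ℂ → ℂ} (hf : Meromorphic f)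
    (hf₀ : ∀ z, meromorphicOrderAt f z ≠ ⊤) {R : ℝ} (hR : 1 ≤ R) {s : Finset ℂ}
    (hs : (divisor f (closedBall 0 R)).support = s) {w₁ w₂ : ℂ} (h₁ : ‖w₁‖ ≤ R / 2)
    (h₂ : ‖w₂‖ ≤ R / 2) (ha₁ : AnalyticAt ℂ f w₁) (hn₁ : f w₁ ≠ 0) (ha₂ : AnalyticAt ℂ f w₂)
    (hn₂ : f w₂ ≠ 0) :
    log ‖f w₁‖ - log ‖f w₂‖ ≤
      ∑ u ∈ s, |(divisor f (closedBall 0 R) u : ℝ)| * |log ‖w₁ - u‖ - log ‖w₂ - u‖| +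
      8 * ‖w₁ - w₂‖ / R * (proximity f ⊤ R + proximity f 0 R +
        2 * log (2 * R) * ∑ u ∈ s, |(divisor f (closedBall 0 R) u : ℝ)|) := by
  have hR0 : 0 < R := by linarith
  set U : Set ℂ := closedBall 0 R with hU
  set D := divisor f U with hD
  have hfin : D.support.Finite := by rw [hs]; exact s.finite_toSet
  have hfU : MeromorphicOn f U := fun z _ ↦ hf z
  -- Here g is analytic and zero-free on the closed disk, so log|g| is harmonic there; the
  -- factorization holds off a discrete set, which circle averages do not see.
  obtain ⟨g, h₁g, h₂g, h₃g⟩ := hfU.extract_zeros_poles (fun u ↦ hf₀ u) hfin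
  have hsupp : ∀ φ : ℂ → ℝ, (fun u ↦ (D u : ℝ) * φ u).support ⊆ s := fun φ u hu ↦ by
    rw [← hs]
    intro h0
    simp [h0] at hu
  have hval : ∀ w : ℂ, ‖w‖ ≤ R / 2 → AnalyticAt ℂ f w → f w ≠ 0 →
      log ‖f w‖ = ∑ u ∈ s, (D u : ℝ) * log ‖w - u‖ + log ‖g w‖ := by
    intro w hw ha hn
    have hwb : w ∈ ball (0 : ℂ) R := by rw [mem_ball_zero_iff]; linarith
    have hwU : w ∈ U := ball_subset_closedBall hwb
    have t₁ : AccPt w (𝓟 U) := by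
      apply accPt_iff_frequently_nhdsNE.mpr
      apply compl_notMem
      apply mem_nhdsWithin.mpr
      exact ⟨ball 0 R, isOpen_ball, hwb, fun _ ⟨h, _⟩ ↦ by
        exact ball_subset_closedBall h⟩
    have := log_norm_meromorphicTrailingCoeffAt_extract_zeros_poles hfin hwU t₁ (hf w)
      (h₁g w hwU) (h₂g ⟨w, hwU⟩) h₃g
    rwa [ha.meromorphicTrailingCoeffAt_of_ne_zero hn,
      finsum_eq_sum_of_support_subset _ (hsupp _)] at this
  have hharm : InnerProductSpace.HarmonicOnNhd (fun z ↦ log ‖g z‖) U :=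
    fun x hx ↦ (h₁g x hx).harmonicAt_log_norm (h₂g ⟨x, hx⟩)
  have hosc := abs_sub_le_circleAverage_abs_of_harmonic hR0 hharm h₁ h₂
  have hfi : CircleIntegrable (fun z ↦ log ‖f z‖) 0 R :=
    MeromorphicOn.circleIntegrable_log_norm fun z _ ↦ hf z
  have hui : ∀ u : ℂ, CircleIntegrable (fun z ↦ log ‖z - u‖) 0 R := fun u ↦
    circleIntegrable_log_norm_sub_const R
  have hlog : (fun z ↦ |log ‖g z‖|) =ᶠ[codiscreteWithin (sphere 0 |R|)]
      fun z ↦ |log ‖f z‖ - ∑ u ∈ s, (D u : ℝ) * log ‖z - u‖| := by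
    have h4 := extract_zeros_poles_log h₂g h₃g
    have hsub : sphere (0 : ℂ) |R| ⊆ U := by
      rw [abs_of_pos hR0]; exact sphere_subset_closedBall
    filter_upwards [codiscreteWithin_mono hsub h4] with z hz
    rw [← hD, finsum_eq_sum_of_support_subset (s := s)] at hz
    · simp only [Pi.add_apply, Finset.sum_apply] at hz
      rw [hz]
      congr 1
      simp
    · intro u hu
      rw [← hs]
      intro h0
      apply hu
      ext z
      simp [h0]
  have havg : circleAverage (fun z ↦ |log ‖g z‖|) 0 R ≤ proximity f ⊤ R + proximity f 0 R +
        2 * log (2 * R) * ∑ u ∈ s, |(D u : ℝ)| := by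
    have hfi' : CircleIntegrable (fun z ↦ |log ‖f z‖|) 0 R := hfi.abs
    have hui' : ∀ u ∈ s, CircleIntegrable (fun z ↦ |(D u : ℝ)| * |log ‖z - u‖|) 0 R :=
      fun u _ ↦ (hui u).abs.const_smul
    have hSi : CircleIntegrable (fun z ↦ ∑ u ∈ s, |(D u : ℝ)| * |log ‖z - u‖|) 0 R :=
      CircleIntegrable.fun_sum s hui'
    have hDi : CircleIntegrable (fun z ↦ ∑ u ∈ s, (D u : ℝ) * log ‖z - u‖) 0 R :=
      CircleIntegrable.fun_sum s fun u _ ↦ (hui u).const_smul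
    have hfp : circleAverage (fun z ↦ |log ‖f z‖|) 0 R = proximity f ⊤ R + proximity f 0 R := by
      rw [proximity_top, proximity_zero_of_complexValued, ← circleAverage_fun_add
        (MeromorphicOn.circleIntegrable_posLog_norm fun z _ ↦ hf z)
        (MeromorphicOn.circleIntegrable_posLog_norm fun z _ ↦ hf.inv z)]
      congr 1
      ext z
      rw [Pi.inv_apply, norm_inv, posLog_apply, posLog_apply, log_inv]
      rcases le_total (log ‖f z‖) 0 with h | h
      · rw [abs_of_nonpos h, max_eq_left h, max_eq_right (by linarith), zero_add]
      · rw [abs_of_nonneg h, max_eq_right h, max_eq_left (by linarith), add_zero]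
    rw [circleAverage_congr_codiscreteWithin hlog hR0.ne', ← hfp]
    calc circleAverage (fun z ↦ |log ‖f z‖ - ∑ u ∈ s, (D u : ℝ) * log ‖z - u‖|) 0 R
        ≤ circleAverage (fun z ↦ |log ‖f z‖| + ∑ u ∈ s, |(D u : ℝ)| * |log ‖z - u‖|) 0 R := by
          refine circleAverage_mono (hfi.sub hDi).abs (hfi'.add hSi) fun z _ ↦ ?_
          refine (abs_sub _ _).trans ?_
          gcongr
          refine (Finset.abs_sum_le_sum_abs _ _).trans_eq ?_
          simp only [abs_mul]
      _ = circleAverage (fun z ↦ |log ‖f z‖|) 0 R +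
          ∑ u ∈ s, |(D u : ℝ)| * circleAverage (fun z ↦ |log ‖z - u‖|) 0 R := by
          rw [circleAverage_fun_add hfi' hSi, circleAverage_fun_sum hui']
          congr 1
          refine Finset.sum_congr rfl fun u _ ↦ ?_
          simp only [← smul_eq_mul]
          exact circleAverage_fun_smul
      _ ≤ _ := by
          rw [mul_comm _ (∑ u ∈ s, |(D u : ℝ)|), Finset.sum_mul]
          gcongr with u hu
          refine circleAverage_abs_log_norm_sub_le hR ?_
          have : u ∈ U := D.supportWithinDomain (by rw [hs]; exact hu)
          simpa [hU] using this
  rw [hval w₁ h₁ ha₁ hn₁, hval w₂ h₂ ha₂ hn₂]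
  have hsum : ∑ u ∈ s, (D u : ℝ) * log ‖w₁ - u‖ - ∑ u ∈ s, (D u : ℝ) * log ‖w₂ - u‖ ≤
      ∑ u ∈ s, |(D u : ℝ)| * |log ‖w₁ - u‖ - log ‖w₂ - u‖| := by
    rw [← Finset.sum_sub_distrib]
    refine Finset.sum_le_sum fun u _ ↦ ?_
    rw [← mul_sub, ← abs_mul]
    exact le_abs_self _
  have h5 := (le_abs_self _).trans (hosc.trans
    (mul_le_mul_of_nonneg_left havg (by positivity)))
  linarith

open Metric Real ValueDistribution MeromorphicOn in
-- A nonzero point u with |u| ≤ R enters the counting functions at radius 2R with weight log(2R/|u|)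
-- ≥ log 2. The origin has its own term, with weight log(2R).
theorem sum_abs_divisor_mul_log_two_le {f : ℂ → ℂ} (hf : Meromorphic f) {R : ℝ} (hR : 1 ≤ R)
    {s : Finset ℂ} (hs : (divisor f (closedBall 0 R)).support = s) :
    (∑ u ∈ s, |(divisor f (closedBall 0 R) u : ℝ)|) * log 2 ≤
      logCounting f 0 (2 * R) + logCounting f ⊤ (2 * R) := by
  have hR0 : 0 < R := by linarith
  set D := divisor f Set.univ with hD
  have hE : logCounting f 0 (2 * R) + logCounting f ⊤ (2 * R) =
      Function.locallyFinsuppWithin.logCounting (D⁺ + D⁻) (2 * R) := by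
    rw [logCounting_zero, logCounting_top, map_add]; rfl
  have hEu : ∀ u, ((D⁺ + D⁻) u : ℤ) = |D u| := fun u ↦ by
    rw [Function.locallyFinsuppWithin.coe_add, Pi.add_apply]
    exact posPart_add_negPart (D u)
  set E := D⁺ + D⁻ with hEdef
  have hEnn : ∀ u, (0 : ℝ) ≤ E u := fun u ↦ by rw [hEu]; positivity
  have hDs : ∀ u, u ∈ closedBall (0 : ℂ) R → divisor f (closedBall 0 R) u = D u := fun u hu ↦ by
    rw [hD, divisor_apply (fun z _ ↦ hf z) hu, divisor_apply (fun z _ ↦ hf z) (Set.mem_univ u)]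
  have hsb : ∀ u ∈ s, u ∈ closedBall (0 : ℂ) R := fun u hu ↦
    (divisor f (closedBall 0 R)).supportWithinDomain (by rw [hs]; exact hu)
  rw [hE]
  change _ ≤ ∑ᶠ z, (E.toClosedBall (2 * R) z : ℝ) * log (2 * R * ‖z‖⁻¹) + (E 0 : ℝ) * log (2 * R)
  have hfin := (E.toClosedBall (2 * R)).finiteSupport (isCompact_closedBall 0 |2 * R|)
  have hsub : (fun z ↦ (E.toClosedBall (2 * R) z : ℝ) * log (2 * R * ‖z‖⁻¹)).support ⊆
      (hfin.toFinset ∪ s : Finset ℂ) := fun z hz ↦ by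
    rw [Finset.coe_union]
    left
    rw [Set.Finite.coe_toFinset]
    intro h0
    simp [h0] at hz
  have hmem : ∀ z : ℂ, z ∈ closedBall (0 : ℂ) |2 * R| ↔ ‖z‖ ≤ 2 * R := fun z ↦ by
    rw [mem_closedBall_zero_iff, abs_of_pos (by linarith)]
  have hnn : ∀ z, 0 ≤ (E.toClosedBall (2 * R) z : ℝ) * log (2 * R * ‖z‖⁻¹) := fun z ↦ by
    by_cases hz : z ∈ closedBall (0 : ℂ) |2 * R|
    · rw [Function.locallyFinsuppWithin.toClosedBall_eval_within _ hz]
      refine mul_nonneg (hEnn z) ?_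
      rcases eq_or_ne z 0 with rfl | h0
      · simp
      · refine log_nonneg ?_
        rw [← div_eq_mul_inv, le_div_iff₀ (norm_pos_iff.2 h0), one_mul]
        exact (hmem z).1 hz
    · have : E.toClosedBall (2 * R) z = 0 :=
        (E.toClosedBall (2 * R)).apply_eq_zero_of_notMem hz
      simp [this]
  rw [finsum_eq_sum_of_support_subset _ hsub]
  have hterm : ∀ u ∈ s, |(divisor f (closedBall 0 R) u : ℝ)| * log 2 ≤
      (E.toClosedBall (2 * R) u : ℝ) * log (2 * R * ‖u‖⁻¹) +
        if u = 0 then (E 0 : ℝ) * log (2 * R) else 0 := by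
    intro u hu
    have hu1 : ‖u‖ ≤ R := by simpa using hsb u hu
    rw [hDs u (hsb u hu), Function.locallyFinsuppWithin.toClosedBall_eval_within _
      ((hmem u).2 (by linarith)), ← Int.cast_abs, ← hEu]
    split_ifs with h0
    · subst h0
      have : log 2 ≤ log (2 * R) := log_le_log (by norm_num) (by linarith)
      simpa using mul_le_mul_of_nonneg_left this (hEnn 0)
    · rw [add_zero]
      refine mul_le_mul_of_nonneg_left (log_le_log (by norm_num) ?_) (hEnn u)
      rw [← div_eq_mul_inv, le_div_iff₀ (norm_pos_iff.2 h0)]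
      linarith
  rw [Finset.sum_mul]
  refine (Finset.sum_le_sum hterm).trans ?_
  rw [Finset.sum_add_distrib]
  refine add_le_add ?_ ?_
  · exact Finset.sum_le_sum_of_subset_of_nonneg Finset.subset_union_right fun z _ _ ↦ hnn z
  · rw [Finset.sum_ite_eq']
    split_ifs
    · exact le_rfl
    · exact mul_nonneg (hEnn 0) (log_nonneg (by linarith))

/-! ### Differences of logarithms and Riesz potentials on the line -/

theorem Real.log_one_add_le_rpow_div {t β : ℝ} (ht : 0 ≤ t) (hβ : 0 < β) (hβ₁ : β ≤ 1) :
    Real.log (1 + t) ≤ t ^ β / β := by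
  have h1 : (1 + t) ^ β ≤ 1 + t ^ β := by
    simpa using Real.rpow_add_le_add_rpow zero_le_one ht hβ.le hβ₁
  have h2 : Real.log ((1 + t) ^ β) ≤ (1 + t) ^ β - 1 :=
    Real.log_le_sub_one_of_pos (Real.rpow_pos_of_pos (by linarith) _)
  rw [Real.log_rpow (by linarith)] at h2
  rw [le_div_iff₀ hβ]
  linarith

/-- Trades the mean value bound d/min(x, y) for a singularity of exponent β, which is integrable
when β < 1. -/
theorem Real.abs_log_sub_log_le_rpow {x y d β : ℝ} (hx : 0 < x) (hy : 0 < y) (hd : |x - y| ≤ d)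
    (hβ : 0 < β) (hβ₁ : β ≤ 1) :
    |Real.log x - Real.log y| ≤ d ^ β / β * (x ^ (-β) + y ^ (-β)) := by
  have key : ∀ x y : ℝ, 0 < x → 0 < y → |x - y| ≤ d →
      Real.log x - Real.log y ≤ d ^ β / β * y ^ (-β) := by
    intro x y hx hy hd
    have hd0 : 0 ≤ d := (abs_nonneg _).trans hd
    have hle : x ≤ y * (1 + d / y) := by
      have := (le_abs_self _).trans hd
      field_simp
      linarith
    have h1 := Real.log_le_log hx hle
    rw [Real.log_mul hy.ne' (by positivity)] at h1
    have h2 := Real.log_one_add_le_rpow_div (div_nonneg hd0 hy.le) hβ hβ₁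
    rw [Real.div_rpow hd0 hy.le] at h2
    rw [Real.rpow_neg hy.le]
    calc _ ≤ d ^ β / y ^ β / β := by linarith
      _ = _ := by field_simp
  have hd0 : 0 ≤ d := (abs_nonneg _).trans hd
  have p1 : 0 ≤ d ^ β / β * x ^ (-β) := by positivity
  have p2 : 0 ≤ d ^ β / β * y ^ (-β) := by positivity
  rw [mul_add, abs_le]
  have k1 := key x y hx hy hd
  have k2 := key y x hy hx (by rwa [abs_sub_comm])
  constructor <;> linarith

theorem lintegral_rpow_neg_Ioc {ℓ β : ℝ} (hℓ : 0 ≤ ℓ) (hβ₁ : β < 1) :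
    ∫⁻ x in Set.Ioc 0 ℓ, ENNReal.ofReal (x ^ (-β)) = ENNReal.ofReal (ℓ ^ (1 - β) / (1 - β)) := by
  have hi : IntervalIntegrable (fun x : ℝ ↦ x ^ (-β)) volume 0 ℓ :=
    intervalIntegral.intervalIntegrable_rpow' (by linarith)
  rw [← ofReal_integral_eq_lintegral_ofReal
    ((intervalIntegrable_iff_integrableOn_Ioc_of_le hℓ).1 hi),
    ← intervalIntegral.integral_of_le hℓ, integral_rpow (Or.inl (by linarith))]
  · rw [Real.zero_rpow (by linarith), sub_zero, neg_add_eq_sub]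
  · refine (ae_restrict_iff' measurableSet_Ioc).2 (Eventually.of_forall fun x hx ↦ ?_)
    exact Real.rpow_nonneg hx.1.le _

/-- With ℓ = b - a, points farther than ℓ from t have integrand at most ℓ^{-β}; nearer ones cost at
most two copies of the integral of x^{-β} over (0, ℓ]. The bound is uniform in t. -/
theorem lintegral_abs_sub_rpow_neg_le {a b t β : ℝ} (hab : a < b) (hβ : 0 < β) (hβ₁ : β < 1) :
    ∫⁻ x in Set.Icc a b, ENNReal.ofReal (|x - t| ^ (-β)) ≤
      ENNReal.ofReal ((1 + 2 / (1 - β)) * (b - a) ^ (1 - β)) := by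
  set ℓ := b - a with hℓdef
  have hℓ : 0 < ℓ := sub_pos.2 hab
  have hβ' : 0 < 1 - β := by linarith
  set φ : ℝ → ENNReal := (Set.Ioc 0 ℓ).indicator fun x ↦ ENNReal.ofReal (x ^ (-β)) with hφ
  have hφm : Measurable φ := by
    refine Measurable.indicator ?_ measurableSet_Ioc
    fun_prop
  have hφi : ∫⁻ x, φ x = ENNReal.ofReal (ℓ ^ (1 - β) / (1 - β)) := by
    rw [hφ, lintegral_indicator measurableSet_Ioc, lintegral_rpow_neg_Ioc hℓ.le hβ₁]
  have hpt : ∀ x, ENNReal.ofReal (|x - t| ^ (-β)) ≤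
      ENNReal.ofReal (ℓ ^ (-β)) + (φ (x - t) + φ (t - x)) := by
    intro x
    rcases lt_trichotomy x t with h | h | h
    · by_cases hl : t - x ≤ ℓ
      · have : φ (t - x) = ENNReal.ofReal (|x - t| ^ (-β)) := by
          rw [hφ, Set.indicator_of_mem (show t - x ∈ Set.Ioc 0 ℓ from ⟨by linarith, hl⟩),
            abs_sub_comm, abs_of_pos (by linarith)]
        rw [this]
        exact le_add_self.trans le_add_self
      · refine le_trans (ENNReal.ofReal_le_ofReal ?_) le_self_add
        refine Real.rpow_le_rpow_of_nonpos hℓ ?_ (by linarith)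
        rw [abs_sub_comm, abs_of_pos (by linarith)]
        linarith
    · subst h
      -- The convention 0^{-β} = 0 applies at the singular point.
      rw [sub_self, abs_zero, Real.zero_rpow (by linarith), ENNReal.ofReal_zero]
      exact zero_le
    · by_cases hl : x - t ≤ ℓ
      · have : φ (x - t) = ENNReal.ofReal (|x - t| ^ (-β)) := by
          rw [hφ, Set.indicator_of_mem (show x - t ∈ Set.Ioc 0 ℓ from ⟨by linarith, hl⟩),
            abs_of_pos (by linarith)]
        rw [this]
        exact le_self_add.trans le_add_self
      · refine le_trans (ENNReal.ofReal_le_ofReal ?_) le_self_add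
        refine Real.rpow_le_rpow_of_nonpos hℓ ?_ (by linarith)
        rw [abs_of_pos (by linarith)]
        linarith
  calc ∫⁻ x in Set.Icc a b, ENNReal.ofReal (|x - t| ^ (-β))
      ≤ ∫⁻ x in Set.Icc a b, (ENNReal.ofReal (ℓ ^ (-β)) + (φ (x - t) + φ (t - x))) :=
        lintegral_mono hpt
    _ = ENNReal.ofReal (ℓ ^ (-β)) * ENNReal.ofReal ℓ +
        ∫⁻ x in Set.Icc a b, (φ (x - t) + φ (t - x)) := by
        rw [lintegral_add_left measurable_const, setLIntegral_const, Real.volume_Icc]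
    _ ≤ ENNReal.ofReal (ℓ ^ (-β)) * ENNReal.ofReal ℓ + ∫⁻ x, (φ (x - t) + φ (t - x)) := by
        gcongr
        exact Measure.restrict_le_self
    _ = ENNReal.ofReal ((1 + 2 / (1 - β)) * ℓ ^ (1 - β)) := by
        rw [lintegral_add_left (by fun_prop), lintegral_sub_right_eq_self φ t,
          lintegral_sub_left_eq_self φ t, hφi, ← ENNReal.ofReal_mul (by positivity),
          ← ENNReal.ofReal_add (by positivity) (by positivity),
          ← ENNReal.ofReal_add (by positivity) (by positivity)]
        congr 1
        have : ℓ ^ (-β) * ℓ = ℓ ^ (1 - β) := by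
          rw [sub_eq_neg_add, Real.rpow_add_one hℓ.ne']
        rw [this]
        field_simp
        ring

open Metric ValueDistribution MeromorphicOn in
-- By the first main theorem T(r, 1/f) differs from T(r, f) by a constant, absorbed since τ ≥ 1.
-- Counting points in radius R costs the characteristic at 2R.
theorem Meromorphic.exists_proximity_and_divisor_le {f : ℂ → ℂ} (hf : Meromorphic f) :
    ∃ K : ℝ, 0 < K ∧ ∀ R : ℝ, 1 ≤ R → ∀ τ : ℝ, 1 ≤ τ → characteristic f ⊤ R ≤ τ →
      characteristic f ⊤ (2 * R) ≤ τ → ∀ s : Finset ℂ,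
      (divisor f (closedBall 0 R)).support = s →
      proximity f ⊤ R + proximity f 0 R ≤ K * τ ∧
        ∑ u ∈ s, |(divisor f (closedBall 0 R) u : ℝ)| ≤ K * τ := by
  set κ : ℝ := |Real.log ‖meromorphicTrailingCoeffAt f 0‖| with hκ
  have hlog : 0 < Real.log 2 := Real.log_pos (by norm_num)
  have hlog1 : Real.log 2 ≤ 1 := by linarith [Real.log_two_lt_d9]
  refine ⟨(2 + κ) / Real.log 2, by positivity, fun R hR τ hτ h1 h2 s hs ↦ ?_⟩
  have hinv : ∀ r : ℝ, 1 ≤ r → characteristic f ⊤ r ≤ τ →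
      characteristic f⁻¹ ⊤ r ≤ τ + κ := fun r hr h ↦ by
    have := characteristic_sub_characteristic_inv_of_ne_zero hf (R := r) (by linarith)
    have := neg_abs_le (Real.log ‖meromorphicTrailingCoeffAt f 0‖)
    linarith
  have hκ0 : 0 ≤ κ := abs_nonneg _
  have hκτ : κ ≤ κ * τ := le_mul_of_one_le_right hκ0 hτ
  constructor
  · have e1 : proximity f ⊤ R ≤ characteristic f ⊤ R :=
      le_add_of_nonneg_right (logCounting_nonneg hR)
    have e2 : proximity f 0 R ≤ characteristic f⁻¹ ⊤ R := by
      rw [← proximity_inv]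
      exact le_add_of_nonneg_right (logCounting_nonneg hR)
    have e3 := hinv R hR h1
    calc _ ≤ (2 + κ) * τ := by linarith
      _ ≤ _ := by
        gcongr
        rw [le_div_iff₀ hlog]
        exact mul_le_of_le_one_right (by positivity) hlog1
  · have e1 : logCounting f ⊤ (2 * R) ≤ characteristic f ⊤ (2 * R) :=
      le_add_of_nonneg_left (proximity_nonneg _)
    have e2 : logCounting f 0 (2 * R) ≤ characteristic f⁻¹ ⊤ (2 * R) := by
      rw [← logCounting_inv]
      exact le_add_of_nonneg_left (proximity_nonneg _)
    have e3 := hinv (2 * R) (by linarith) h2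
    have e4 := sum_abs_divisor_mul_log_two_le hf hR hs
    rw [div_mul_eq_mul_div, le_div_iff₀ hlog]
    linarith

/-! ### Logarithmic measure and exceptional sets -/

theorem logMeasure_mono {S T : Set ℝ} (h : S ⊆ T) : logMeasure S ≤ logMeasure T :=
  lintegral_mono_set (Set.inter_subset_inter_left _ h)

theorem logMeasure_union_le (S T : Set ℝ) : logMeasure (S ∪ T) ≤ logMeasure S + logMeasure T := by
  unfold logMeasure
  rw [Set.union_inter_distrib_right]
  exact lintegral_union_le _ _ _

theorem logMeasure_iUnion_le (S : ℕ → Set ℝ) : logMeasure (⋃ m, S m) ≤ ∑' m, logMeasure (S m) := by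
  unfold logMeasure
  rw [Set.iUnion_inter]
  exact lintegral_iUnion_le _ _

theorem Set.Countable.logMeasure_eq_zero {S : Set ℝ} (h : S.Countable) : logMeasure S = 0 :=
  setLIntegral_measure_zero _ _ ((h.mono Set.inter_subset_left).measure_zero volume)

theorem logMeasure_le_mul_volume {S : Set ℝ} (hS : MeasurableSet S) {x : ℝ} (hx : 0 < x)
    (h : ∀ t ∈ S, x ≤ t) : logMeasure S ≤ ENNReal.ofReal x⁻¹ * volume S :=
  calc logMeasure S ≤ ∫⁻ t in S, ENNReal.ofReal t⁻¹ := lintegral_mono_set Set.inter_subset_left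
    _ ≤ ∫⁻ _ in S, ENNReal.ofReal x⁻¹ := setLIntegral_mono' hS fun t ht ↦
        ENNReal.ofReal_le_ofReal (inv_anti₀ hx (h t ht))
    _ = _ := setLIntegral_const _ _

theorem logMeasure_Iic_lt_top (x : ℝ) : logMeasure (Set.Iic x) < ⊤ := by
  have h : Set.Iic x ∩ Set.Ici 1 = Set.Icc 1 x := Set.inter_comm _ _
  calc logMeasure (Set.Iic x) = ∫⁻ t in Set.Icc 1 x, ENNReal.ofReal t⁻¹ := by rw [logMeasure, h]
    _ ≤ ∫⁻ _ in Set.Icc 1 x, 1 := setLIntegral_mono' measurableSet_Icc fun t ht ↦ by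
        rw [← ENNReal.ofReal_one]
        exact ENNReal.ofReal_le_ofReal (inv_le_one_of_one_le₀ ht.1)
    _ < ⊤ := by
        rw [setLIntegral_const, Real.volume_Icc, one_mul]
        exact ENNReal.ofReal_lt_top

theorem upperLogDensity_eq_zero {S : Set ℝ} (h : logMeasure S < ⊤) : upperLogDensity S = 0 := by
  have ht : Tendsto (fun r : ℝ ↦ logMeasure S / ENNReal.ofReal (Real.log r)) atTop (𝓝 0) := by
    have := ENNReal.Tendsto.const_div (a := logMeasure S)
      (ENNReal.tendsto_ofReal_atTop.comp Real.tendsto_log_atTop) (Or.inr h.ne)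
    rwa [ENNReal.div_top] at this
  refine le_antisymm ?_ zero_le
  rw [← ht.limsup_eq]
  refine limsup_le_limsup (Eventually.of_forall fun r ↦ ?_)
  exact ENNReal.div_le_div_right (logMeasure_mono Set.inter_subset_left) _

/-- A Markov type bound for the size of the set where a sum of Riesz potentials is large. -/
theorem volume_le_of_sum_rpow_neg {ι κ : Type*} (s : Finset κ) (I : Finset ι) (d : κ → ℝ)
    (hd : ∀ u ∈ s, 0 ≤ d u) (t : κ → ι → ℝ) {a b β v : ℝ} (hab : a < b) (hβ : 0 < β)
    (hβ₁ : β < 1) (hv : 0 < v) :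
    volume {r ∈ Set.Icc a b | v ≤ ∑ u ∈ s, d u * ∑ i ∈ I, |r - t u i| ^ (-β)} ≤
      ENNReal.ofReal ((∑ u ∈ s, d u) * I.card * ((1 + 2 / (1 - β)) * (b - a) ^ (1 - β)) / v) := by
  have hQm : Measurable fun r : ℝ ↦ ∑ u ∈ s, d u * ∑ i ∈ I, |r - t u i| ^ (-β) := by fun_prop
  have hmark := mul_meas_ge_le_lintegral₀ (μ := volume.restrict (Set.Icc a b))
    (hQm.ennreal_ofReal).aemeasurable (ENNReal.ofReal v)
  have hset : {r ∈ Set.Icc a b | v ≤ ∑ u ∈ s, d u * ∑ i ∈ I, |r - t u i| ^ (-β)} ⊆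
      {r | ENNReal.ofReal v ≤ ENNReal.ofReal (∑ u ∈ s, d u * ∑ i ∈ I, |r - t u i| ^ (-β))} ∩
        Set.Icc a b := fun r hr ↦ ⟨ENNReal.ofReal_le_ofReal hr.2, hr.1⟩
  have hint : ∫⁻ r in Set.Icc a b,
      ENNReal.ofReal (∑ u ∈ s, d u * ∑ i ∈ I, |r - t u i| ^ (-β)) ≤
      ENNReal.ofReal ((∑ u ∈ s, d u) * I.card * ((1 + 2 / (1 - β)) * (b - a) ^ (1 - β))) := by
    calc ∫⁻ r in Set.Icc a b, ENNReal.ofReal (∑ u ∈ s, d u * ∑ i ∈ I, |r - t u i| ^ (-β))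
        = ∫⁻ r in Set.Icc a b, ∑ u ∈ s, ENNReal.ofReal (d u) *
            ∑ i ∈ I, ENNReal.ofReal (|r - t u i| ^ (-β)) := by
          refine lintegral_congr fun r ↦ ?_
          rw [ENNReal.ofReal_sum_of_nonneg fun u hu ↦ mul_nonneg (hd u hu)
            (Finset.sum_nonneg fun i _ ↦ by positivity)]
          refine Finset.sum_congr rfl fun u hu ↦ ?_
          rw [ENNReal.ofReal_mul (hd u hu), ENNReal.ofReal_sum_of_nonneg fun i _ ↦ by positivity]
      _ = ∑ u ∈ s, ENNReal.ofReal (d u) *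
            ∑ i ∈ I, ∫⁻ r in Set.Icc a b, ENNReal.ofReal (|r - t u i| ^ (-β)) := by
          rw [lintegral_finsetSum _ fun u _ ↦ by fun_prop]
          refine Finset.sum_congr rfl fun u _ ↦ ?_
          rw [lintegral_const_mul _ (by fun_prop), lintegral_finsetSum _ fun i _ ↦ by fun_prop]
      _ ≤ ∑ u ∈ s, ENNReal.ofReal (d u) *
            ∑ i ∈ I, ENNReal.ofReal ((1 + 2 / (1 - β)) * (b - a) ^ (1 - β)) := by
          gcongr with u _ i _
          exact lintegral_abs_sub_rpow_neg_le hab hβ hβ₁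
      _ = _ := by
          rw [Finset.sum_const, ← Finset.sum_mul, ← ENNReal.ofReal_sum_of_nonneg hd, nsmul_eq_mul,
            ← mul_assoc, ENNReal.ofReal_mul (p := (∑ u ∈ s, d u) * I.card)
              (by have := Finset.sum_nonneg hd; positivity),
            ENNReal.ofReal_mul (Finset.sum_nonneg hd), ENNReal.ofReal_natCast]
  rw [ENNReal.ofReal_div_of_pos hv, ENNReal.le_div_iff_mul_le
    (Or.inl (ENNReal.ofReal_pos.2 hv).ne') (Or.inl ENNReal.ofReal_ne_top), mul_comm]
  refine le_trans ?_ (hmark.trans hint)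
  exact mul_le_mul' le_rfl ((measure_mono hset).trans (Measure.le_restrict_apply _ _))

theorem Meromorphic.eventually_codiscrete_analyticAt_ne_zero {f : ℂ → ℂ} (hf : Meromorphic f)
    (hf₀ : ∀ z, meromorphicOrderAt f z ≠ ⊤) :
    ∀ᶠ z in codiscrete ℂ, AnalyticAt ℂ f z ∧ f z ≠ 0 := by
  have h1 : ∀ᶠ z in codiscrete ℂ, AnalyticAt ℂ f z := by
    rw [Filter.Eventually, mem_codiscrete]
    intro x
    rw [disjoint_principal_right, compl_compl]
    exact (hf x).eventually_analyticAt
  have h2 : ∀ᶠ z in codiscrete ℂ, f z ≠ 0 := by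
    rw [Filter.Eventually, mem_codiscrete]
    intro x
    rw [disjoint_principal_right, compl_compl]
    exact (meromorphicOrderAt_ne_top_iff_eventually_ne_zero (hf x)).1 (hf₀ x)
  exact h1.and h2

/-- Serves the harmonic part at R = 2^{m+3}: the factor 2m + 9 = 1 + 2(m + 4) comes from log(2R) ≤ m
+ 4, and 1/2 is its share of the final bound. -/
theorem exists_forall_linear_mul_le_rpow (C : ℝ) {θ : ℝ} (hθ₁ : θ < 1) :
    ∃ m₀ : ℕ, ∀ m : ℕ, m₀ ≤ m →
      C * (2 * m + 9) / 2 ^ m ≤ 2⁻¹ * ((2 : ℝ) ^ (m + 1)) ^ (-θ) := by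
  have hb0 : (0 : ℝ) ≤ 2 ^ (θ - 1) := by positivity
  have hb1 : (2 : ℝ) ^ (θ - 1) < 1 := Real.rpow_lt_one_of_one_lt_of_neg (by norm_num) (by linarith)
  have t1 := tendsto_self_mul_const_pow_of_lt_one hb0 hb1
  have t2 := tendsto_pow_atTop_nhds_zero_of_lt_one hb0 hb1
  have t3 : Tendsto (fun m : ℕ ↦ 2 * C * (2 * (m * ((2 : ℝ) ^ (θ - 1)) ^ m) +
      9 * ((2 : ℝ) ^ (θ - 1)) ^ m)) atTop (𝓝 0) := by
    have := ((t1.const_mul 2).add (t2.const_mul 9)).const_mul (2 * C)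
    simpa using this
  have hpos : (0 : ℝ) < 2 ^ (-θ) := by positivity
  obtain ⟨m₀, hm₀⟩ := eventually_atTop.1 (t3.eventually (gt_mem_nhds hpos))
  refine ⟨m₀, fun m hm ↦ ?_⟩
  have h := (hm₀ m hm).le
  have e1 : ((2 : ℝ) ^ (θ - 1)) ^ m = ((2 : ℝ) ^ m) ^ θ / 2 ^ m := by
    rw [← Real.rpow_natCast, ← Real.rpow_mul (by norm_num), ← Real.rpow_natCast 2 m,
      ← Real.rpow_mul (by norm_num), ← Real.rpow_sub (by norm_num)]
    congr 1
    ring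
  have e2 : ((2 : ℝ) ^ (m + 1)) ^ (-θ) = 2 ^ (-θ) / ((2 : ℝ) ^ m) ^ θ := by
    rw [pow_succ, Real.mul_rpow (by positivity) (by norm_num), Real.rpow_neg (x := (2 : ℝ) ^ m)
      (by positivity), div_eq_inv_mul]
  rw [e1] at h
  rw [e2]
  have hp : 0 < ((2 : ℝ) ^ m) ^ θ := by positivity
  calc C * (2 * m + 9) / 2 ^ m
      = 2⁻¹ * (2 * C * (2 * (m * (((2 : ℝ) ^ m) ^ θ / 2 ^ m)) + 9 * (((2 : ℝ) ^ m) ^ θ / 2 ^ m))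
          / ((2 : ℝ) ^ m) ^ θ) := by
        field_simp
    _ ≤ _ := by gcongr

/-! ### Quotients of shifts -/

open Metric ValueDistribution MeromorphicOn in
/-- Pointwise estimate for quotients of shifts of a meromorphic function, valid for all `z` whose
modulus avoids a set of finite logarithmic measure. -/
theorem Meromorphic.exists_logMeasure_lt_top_log_norm_shift_le {f : ℂ → ℂ} (hf : Meromorphic f)
    (hf₀ : ∀ z, meromorphicOrderAt f z ≠ ⊤) {ι : Type*} [Fintype ι] (c : ι → ℂ) {θ : ℝ}
    (hθ : 0 < θ) (hθ₁ : θ < 1) :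
    ∃ E : Set ℝ, logMeasure E < ⊤ ∧ ∀ z : ℂ, ‖z‖ ∉ E →
      (∀ i, f (z + c i) ≠ 0) ∧ ∀ Y : ℝ, 1 ≤ Y →
        (∀ t ∈ Set.Icc ‖z‖ (16 * ‖z‖), characteristic f ⊤ t ≤ Y) →
        ∀ i j, Real.log ‖f (z + c i)‖ - Real.log ‖f (z + c j)‖ ≤ Y * ‖z‖ ^ (-θ) := by
  obtain ⟨K, hK, hKle⟩ := hf.exists_proximity_and_divisor_le
  obtain ⟨M, hM1, hM⟩ : ∃ M : ℝ, 1 ≤ M ∧ ∀ i, ‖c i‖ ≤ M := by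
    obtain ⟨M, hM⟩ := (Set.finite_range fun i ↦ ‖c i‖).bddAbove
    exact ⟨max 1 M, le_max_left _ _, fun i ↦ (hM ⟨i, rfl⟩).trans (le_max_right _ _)⟩
  -- β < 1 gives integrability; β > θ makes the measures of the bad sets summable.
  set β : ℝ := (1 + θ) / 2 with hβdef
  have hβ : 0 < β := by linarith
  have hβ₁ : β < 1 := by linarith
  -- For 2^m ≤ |z| ≤ 2^{m+1} and |c_i| ≤ 2^m, the shifted points lie within R/2 = 4·2^m, and 2R =
  -- 16·2^m ≤ 16|z|.
  set R : ℕ → ℝ := fun m ↦ 2 ^ (m + 3) with hRdef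
  have hR1 : ∀ m, 1 ≤ R m := fun m ↦ one_le_pow₀ (by norm_num)
  set s : ℕ → Finset ℂ := fun m ↦
    ((divisor f (closedBall 0 (R m))).finiteSupport (isCompact_closedBall 0 (R m))).toFinset
    with hsdef
  have hs : ∀ m, (divisor f (closedBall 0 (R m))).support = s m := fun m ↦ by simp [hsdef]
  set d : ℕ → ℂ → ℝ := fun m u ↦ |(divisor f (closedBall 0 (R m)) u : ℝ)| with hd
  set τ : ℕ → ℝ := fun m ↦
    max 1 (max (characteristic f ⊤ (R m)) (characteristic f ⊤ (2 * R m))) with hτ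
  have hτ1 : ∀ m, 1 ≤ τ m := fun m ↦ le_max_left _ _
  have hKm : ∀ m, proximity f ⊤ (R m) + proximity f 0 (R m) ≤ K * τ m ∧
      ∑ u ∈ s m, d m u ≤ K * τ m := fun m ↦
    hKle (R m) (hR1 m) (τ m) (hτ1 m) ((le_max_left _ _).trans (le_max_right _ _))
      ((le_max_right _ _).trans (le_max_right _ _)) (s m) (hs m)
  set C : ℝ := 2 * ((2 * M) ^ β / β) with hC
  have hCpos : 0 < C := by positivity
  -- The threshold makes C · v half of the target bound.
  set v : ℕ → ℝ := fun m ↦ (2 * C)⁻¹ * τ m * ((2 : ℝ) ^ (m + 1)) ^ (-θ) with hv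
  have hvpos : ∀ m, 0 < v m := fun m ↦ by
    have := hτ1 m
    positivity
  set Q : ℕ → ℝ → ℝ := fun m r ↦ ∑ u ∈ s m, d m u * ∑ i, |r - ‖u - c i‖| ^ (-β) with hQ
  set B : ℕ → Set ℝ := fun m ↦ {r ∈ Set.Icc (2 ^ m) (2 ^ (m + 1)) | v m ≤ Q m r} with hB
  obtain ⟨m₁, hm₁⟩ := exists_forall_linear_mul_le_rpow (2 * M * K) hθ₁
  obtain ⟨m₂, hm₂⟩ := pow_unbounded_of_one_lt M (one_lt_two (α := ℝ))
  set G : Set ℂ := {z | ∀ i, AnalyticAt ℂ f (z + c i) ∧ f (z + c i) ≠ 0} with hG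
  have hGc : Gᶜ.Countable := by
    have hg := countable_compl_of_mem_codiscrete
      (hf.eventually_codiscrete_analyticAt_ne_zero hf₀)
    have : Gᶜ ⊆ ⋃ i, (fun z ↦ z + c i) ⁻¹' {z | AnalyticAt ℂ f z ∧ f z ≠ 0}ᶜ := by
      intro z hz
      simp only [hG, Set.mem_compl_iff, Set.mem_ofPred_eq, not_forall] at hz
      obtain ⟨i, hi⟩ := hz
      exact Set.mem_iUnion.2 ⟨i, hi⟩
    exact (Set.countable_iUnion fun i ↦
      hg.preimage_of_injOn (add_left_injective (c i)).injOn).mono this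
  -- Excluded are small radii, the countably many moduli at which some shift of f vanishes or is not
  -- analytic, and the radii with large potential.
  refine ⟨Set.Iic (2 ^ (max m₁ m₂)) ∪ ((fun z ↦ ‖z‖) '' Gᶜ ∪ ⋃ m, B m), ?_, ?_⟩
  · have hBm : ∀ m, logMeasure (B m) ≤ ENNReal.ofReal
        (2 * C * K * Fintype.card ι * (1 + 2 / (1 - β)) * 2 ^ θ * (2 ^ (θ - β)) ^ m) := by
      intro m
      have hQm : Measurable (Q m) := by fun_prop
      have hBmeas : MeasurableSet (B m) :=
        measurableSet_Icc.inter (measurableSet_le measurable_const hQm)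
      have hlt : (2 : ℝ) ^ m < 2 ^ (m + 1) := pow_lt_pow_right₀ (by norm_num) (by lia)
      have hvol := volume_le_of_sum_rpow_neg (s m) (Finset.univ : Finset ι) (d m)
        (fun u _ ↦ abs_nonneg _) (fun u i ↦ ‖u - c i‖) hlt hβ hβ₁ (hvpos m)
      refine (logMeasure_le_mul_volume hBmeas (x := 2 ^ m) (by positivity)
        fun t ht ↦ ht.1.1).trans ?_
      refine (mul_le_mul' le_rfl hvol).trans ?_
      rw [← ENNReal.ofReal_mul (by positivity)]
      refine ENNReal.ofReal_le_ofReal ?_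
      have hτpos : 0 < τ m := zero_lt_one.trans_le (hτ1 m)
      have hβ2 : 0 < 1 - β := by linarith
      have hp : (0 : ℝ) < 2 ^ m := by positivity
      rw [show (2 : ℝ) ^ (m + 1) - 2 ^ m = 2 ^ m by ring, Finset.card_univ]
      have e1 : ((2 : ℝ) ^ (θ - β)) ^ m =
          (2 ^ m)⁻¹ * ((2 : ℝ) ^ m) ^ (1 - β) * ((2 : ℝ) ^ m) ^ θ := by
        rw [← Real.rpow_natCast, ← Real.rpow_mul (by norm_num), ← Real.rpow_neg_one (2 ^ m),
          ← Real.rpow_add hp, ← Real.rpow_add hp, ← Real.rpow_natCast 2 m,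
          ← Real.rpow_mul (by norm_num)]
        congr 1
        ring
      have e2 : v m = (2 * C)⁻¹ * τ m * (2 ^ θ * ((2 : ℝ) ^ m) ^ θ)⁻¹ := by
        simp only [hv]
        rw [Real.rpow_neg (by positivity), pow_succ, Real.mul_rpow (by positivity) (by norm_num),
          mul_comm ((2 : ℝ) ^ θ)]
      calc (2 ^ m)⁻¹ * ((∑ u ∈ s m, d m u) * Fintype.card ι *
            ((1 + 2 / (1 - β)) * ((2 : ℝ) ^ m) ^ (1 - β)) / v m)
          ≤ (2 ^ m)⁻¹ * ((K * τ m) * Fintype.card ι *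
            ((1 + 2 / (1 - β)) * ((2 : ℝ) ^ m) ^ (1 - β)) / v m) := by
            have := hvpos m
            gcongr
            exact (hKm m).2
        _ = _ := by
            rw [e1, e2]
            field_simp
    have hsum : ∑' m, logMeasure (B m) < ⊤ := by
      refine (ENNReal.tsum_le_tsum hBm).trans_lt (Summable.tsum_ofReal_lt_top ?_)
      exact (summable_geometric_of_lt_one (by positivity)
        (Real.rpow_lt_one_of_one_lt_of_neg (by norm_num) (by linarith))).mul_left _
    refine (logMeasure_union_le _ _).trans_lt (ENNReal.add_lt_top.2 ⟨logMeasure_Iic_lt_top _, ?_⟩)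
    refine (logMeasure_union_le _ _).trans_lt (ENNReal.add_lt_top.2 ⟨?_, ?_⟩)
    · rw [(hGc.image _).logMeasure_eq_zero]
      exact ENNReal.zero_lt_top
    · exact (logMeasure_iUnion_le _).trans_lt hsum
  · intro z hz
    simp only [Set.mem_union, not_or, Set.mem_Iic, not_le, Set.mem_iUnion, not_exists] at hz
    obtain ⟨hz1, hz2, hz3⟩ := hz
    have hzG : z ∈ G := by
      by_contra h
      exact hz2 ⟨z, h, rfl⟩
    refine ⟨fun i ↦ (hzG i).2, fun Y hY hTY i j ↦ ?_⟩
    have hz0 : (1 : ℝ) ≤ ‖z‖ := (one_le_pow₀ (by norm_num)).trans hz1.le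
    obtain ⟨m, hm, hm'⟩ := exists_nat_pow_near hz0 (one_lt_two (α := ℝ))
    have hmm : max m₁ m₂ ≤ m := by
      have := (pow_lt_pow_iff_right₀ (one_lt_two (α := ℝ))).1 (hz1.trans hm')
      lia
    have hM2 : M ≤ 2 ^ m := hm₂.le.trans
      (pow_le_pow_right₀ (by norm_num) ((le_max_right _ _).trans hmm))
    have hRm : R m = 8 * 2 ^ m := by simp only [hRdef, pow_add]; norm_num; ring
    have h2m : (2 : ℝ) ^ (m + 1) = 2 * 2 ^ m := by ring
    have hτY : τ m ≤ Y := by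
      refine max_le hY (max_le (hTY _ ⟨?_, ?_⟩) (hTY _ ⟨?_, ?_⟩)) <;> rw [hRm] <;> linarith
    have hw : ∀ i, ‖z + c i‖ ≤ R m / 2 := fun i ↦ by
      have := norm_add_le z (c i)
      have := hM i
      rw [hRm]
      linarith
    have hest := hf.log_norm_sub_log_norm_le hf₀ (hR1 m) (hs m) (hw i) (hw j)
      (hzG i).1 (hzG i).2 (hzG j).1 (hzG j).2
    have hcc : ‖(z + c i) - (z + c j)‖ ≤ 2 * M := by
      rw [add_sub_add_left_eq_sub]
      exact (norm_sub_le _ _).trans (by linarith [hM i, hM j])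
    have hQlt : Q m ‖z‖ < v m := by
      by_contra! h
      exact hz3 m ⟨⟨hm, hm'.le⟩, h⟩
    have hpow : ((2 : ℝ) ^ (m + 1)) ^ (-θ) ≤ ‖z‖ ^ (-θ) :=
      Real.rpow_le_rpow_of_nonpos (by linarith) hm'.le (by linarith)
    have part1 : ∑ u ∈ s m, d m u * |Real.log ‖z + c i - u‖ - Real.log ‖z + c j - u‖| ≤
        2⁻¹ * τ m * ((2 : ℝ) ^ (m + 1)) ^ (-θ) := by
      have hterm : ∀ u ∈ s m, ∀ i, 0 < |‖z‖ - ‖u - c i‖| ∧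
          |‖z‖ - ‖u - c i‖| ≤ ‖z + c i - u‖ := by
        intro u hu i
        constructor
        · rw [abs_pos, sub_ne_zero]
          intro heq
          -- Otherwise |z| is the modulus of u - c_i, whose shift by c_i is the zero or pole u; such
          -- moduli are excluded.
          refine hz2 ⟨u - c i, fun hmem ↦ ?_, heq.symm⟩
          obtain ⟨han, hne⟩ := hmem i
          rw [sub_add_cancel] at han hne
          have hu' : divisor f (closedBall 0 (R m)) u ≠ 0 := by
            have : u ∈ (divisor f (closedBall 0 (R m))).support := by rw [hs]; exact hu
            exact this
          have hub : u ∈ closedBall (0 : ℂ) (R m) :=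
            (divisor f (closedBall 0 (R m))).supportWithinDomain hu'
          apply hu'
          rw [divisor_apply (fun z _ ↦ hf z) hub, han.meromorphicOrderAt_eq,
            han.analyticOrderAt_eq_zero.2 hne]
          simp
        · refine (abs_norm_sub_norm_le z (u - c i)).trans_eq ?_
          congr 1
          ring
      have : ∑ u ∈ s m, d m u * |Real.log ‖z + c i - u‖ - Real.log ‖z + c j - u‖| ≤
          C * Q m ‖z‖ := by
        rw [hQ, Finset.mul_sum]
        refine Finset.sum_le_sum fun u hu ↦ ?_
        rw [mul_left_comm]
        refine mul_le_mul_of_nonneg_left ?_ (abs_nonneg _)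
        have hle : ∀ i, ‖z + c i - u‖ ^ (-β) ≤ ∑ i, |‖z‖ - ‖u - c i‖| ^ (-β) := fun i ↦
          (Real.rpow_le_rpow_of_nonpos (hterm u hu i).1 (hterm u hu i).2 (by linarith)).trans
            (Finset.single_le_sum (f := fun i ↦ |‖z‖ - ‖u - c i‖| ^ (-β))
              (fun i _ ↦ by positivity) (Finset.mem_univ i))
        have hpos : ∀ i, 0 < ‖z + c i - u‖ := fun i ↦ (hterm u hu i).1.trans_le (hterm u hu i).2
        refine (Real.abs_log_sub_log_le_rpow (d := 2 * M) (hpos i) (hpos j) ?_ hβ hβ₁.le).trans ?_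
        · refine (abs_norm_sub_norm_le _ _).trans ?_
          rwa [sub_sub_sub_cancel_right]
        · rw [hC]
          have h0 : 0 ≤ (2 * M) ^ β / β := by positivity
          have := mul_le_mul_of_nonneg_left (add_le_add (hle i) (hle j)) h0
          linarith
      refine this.trans ((mul_le_mul_of_nonneg_left hQlt.le hCpos.le).trans_eq ?_)
      rw [hv]
      field_simp
    have part2 : 8 * ‖(z + c i) - (z + c j)‖ / R m * (proximity f ⊤ (R m) + proximity f 0 (R m) +
        2 * Real.log (2 * R m) * ∑ u ∈ s m, d m u) ≤
        2⁻¹ * τ m * ((2 : ℝ) ^ (m + 1)) ^ (-θ) := by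
      have hlog : Real.log (2 * R m) ≤ m + 4 := by
        rw [show 2 * R m = 2 ^ (m + 4) by simp only [hRdef]; ring, Real.log_pow]
        push_cast
        exact mul_le_of_le_one_right (by positivity) (by linarith [Real.log_two_lt_d9])
      have hτpos : 0 < τ m := zero_lt_one.trans_le (hτ1 m)
      have hN0 : 0 ≤ ∑ u ∈ s m, d m u := Finset.sum_nonneg fun u _ ↦ abs_nonneg _
      have hRpos : 0 < R m := zero_lt_one.trans_le (hR1 m)
      calc 8 * ‖(z + c i) - (z + c j)‖ / R m * (proximity f ⊤ (R m) + proximity f 0 (R m) +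
            2 * Real.log (2 * R m) * ∑ u ∈ s m, d m u)
          ≤ 8 * (2 * M) / R m * (K * τ m + 2 * (m + 4) * (K * τ m)) := by
            have hnn : 0 ≤ proximity f ⊤ (R m) + proximity f 0 (R m) :=
              add_nonneg (proximity_nonneg _) (proximity_nonneg _)
            have hl0 : 0 ≤ Real.log (2 * R m) := Real.log_nonneg (by linarith [hR1 m])
            gcongr
            · exact (hKm m).1
            · exact (hKm m).2
        _ = τ m * (2 * M * K * (2 * m + 9) / 2 ^ m) := by
            rw [hRm]
            field_simp
            ring
        _ ≤ τ m * (2⁻¹ * ((2 : ℝ) ^ (m + 1)) ^ (-θ)) := by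
            gcongr
            exact hm₁ m ((le_max_left _ _).trans hmm)
        _ = _ := by ring
    calc _ ≤ 2⁻¹ * τ m * ((2 : ℝ) ^ (m + 1)) ^ (-θ) + 2⁻¹ * τ m * ((2 : ℝ) ^ (m + 1)) ^ (-θ) :=
          hest.trans (add_le_add part1 part2)
      _ = τ m * ((2 : ℝ) ^ (m + 1)) ^ (-θ) := by ring
      _ ≤ Y * ‖z‖ ^ (-θ) := by gcongr

/-! ### Iterated exponentials and logarithms; growth comparisons -/

theorem iterExp_succ (n : ℕ) (x : ℝ) : iterExp (n + 1) x = Real.exp (iterExp n x) :=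
  Function.iterate_succ_apply' _ _ _

theorem iterExp_succ' (n : ℕ) (x : ℝ) : iterExp (n + 1) x = iterExp n (Real.exp x) :=
  Function.iterate_succ_apply _ _ _

theorem iterLog_succ (n : ℕ) (x : ℝ) : iterLog (n + 1) x = Real.log (iterLog n x) :=
  Function.iterate_succ_apply' _ _ _

theorem iterLog_succ' (n : ℕ) (x : ℝ) : iterLog (n + 1) x = iterLog n (Real.log x) :=
  Function.iterate_succ_apply _ _ _

theorem iterExp_monotone (n : ℕ) : Monotone (iterExp n) := Real.exp_monotone.iterate n

theorem le_iterExp (n : ℕ) (x : ℝ) : x ≤ iterExp n x := by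
  induction n with
  | zero => exact le_rfl
  | succ n ih =>
    rw [iterExp_succ]
    linarith [Real.add_one_le_exp (iterExp n x)]

theorem four_mul_exp_le_exp {x y : ℝ} (h : x + 2 ≤ y) : 4 * Real.exp x ≤ Real.exp y := by
  have h1 : Real.exp (x + 2) ≤ Real.exp y := Real.exp_le_exp.2 h
  have h2 : (2 : ℝ) ≤ Real.exp 1 := by linarith [Real.add_one_le_exp (1 : ℝ)]
  have h3 : Real.exp (x + 2) = Real.exp x * (Real.exp 1 * Real.exp 1) := by
    rw [← Real.exp_add, ← Real.exp_add]; norm_num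
  have h4 : (4 : ℝ) ≤ Real.exp 1 * Real.exp 1 := by nlinarith
  rw [h3] at h1
  have := mul_le_mul_of_nonneg_left h4 (Real.exp_nonneg x)
  linarith

theorem iterExp_add_two_le (n : ℕ) {x y : ℝ} (hx : 0 ≤ x) (h : x + 2 ≤ y) :
    iterExp n x + 2 ≤ iterExp n y := by
  induction n with
  | zero => exact h
  | succ n ih =>
    rw [iterExp_succ, iterExp_succ]
    have h1 := four_mul_exp_le_exp ih
    have h2 : 1 ≤ Real.exp (iterExp n x) := Real.one_le_exp (hx.trans (le_iterExp n x))
    linarith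

/-- No largeness of x is needed: where `Real.log` has junk values, x ≤ 0 lies below any exponential.
-/
theorem lt_iterExp_of_iterLog_lt (n : ℕ) {x y : ℝ} (h : iterLog n x < y) : x < iterExp n y := by
  induction n generalizing x with
  | zero => exact h
  | succ n ih =>
    rw [iterLog_succ'] at h
    rw [iterExp_succ]
    rcases le_or_gt x 0 with hx | hx
    · exact hx.trans_lt (Real.exp_pos _)
    · exact (Real.log_lt_iff_lt_exp hx).1 (ih h)

theorem tendsto_iterLog_atTop (n : ℕ) : Tendsto (iterLog n) atTop atTop :=
  Real.tendsto_log_atTop.iterate n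

theorem exists_monotoneOn_iterLog (n : ℕ) : ∃ x₀ : ℝ, MonotoneOn (iterLog n) (Set.Ici x₀) := by
  induction n with
  | zero => exact ⟨0, fun x _ y _ h ↦ h⟩
  | succ n ih =>
    obtain ⟨x₀, h₀⟩ := ih
    obtain ⟨x₁, h₁⟩ := eventually_atTop.1 ((tendsto_iterLog_atTop n).eventually_gt_atTop 0)
    refine ⟨max x₀ x₁, fun x hx y hy h ↦ ?_⟩
    rw [iterLog_succ, iterLog_succ]
    rw [Set.mem_Ici, max_le_iff] at hx hy
    exact Real.log_le_log (h₁ x hx.2) (h₀ hx.1 hy.1 h)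

theorem eventually_iterLog_mul_le (n : ℕ) :
    ∀ᶠ r in atTop, iterLog n (16 * r) ≤ 16 * iterLog n r := by
  induction n with
  | zero => exact Eventually.of_forall fun r ↦ le_rfl
  | succ n ih =>
    have h16 : Tendsto (fun r : ℝ ↦ 16 * r) atTop atTop := tendsto_id.const_mul_atTop (by norm_num)
    filter_upwards [ih, (tendsto_iterLog_atTop n).eventually_gt_atTop 0,
      ((tendsto_iterLog_atTop n).comp h16).eventually_gt_atTop 0,
      (tendsto_iterLog_atTop (n + 1)).eventually_ge_atTop 1] with r h1 h2 h3 h4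
    rw [iterLog_succ] at h4 ⊢
    rw [iterLog_succ]
    have h5 := Real.log_le_log h3 h1
    rw [Real.log_mul (by norm_num) h2.ne', show (16 : ℝ) = 2 ^ 4 by norm_num, Real.log_pow] at h5
    push_cast at h5
    norm_num at h5
    linarith [Real.log_two_lt_d9]

theorem eventually_characteristic_le_of_pqOrder_lt {n m : ℕ} {f : ℂ → ℂ} {t : ℝ}
    (h : pqOrder (n + 1) (m + 1) f < (t : EReal)) :
    ∀ᶠ r in atTop, ValueDistribution.characteristic f ⊤ r ≤ iterExp n (iterLog m r ^ t) := by
  filter_upwards [eventually_lt_of_limsup_lt h,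
    (tendsto_iterLog_atTop (m + 1)).eventually_gt_atTop 0,
    (tendsto_iterLog_atTop m).eventually_gt_atTop 0] with r h1 h2 h3
  have h4 := (div_lt_iff₀ h2).1 (EReal.coe_lt_coe_iff.1 h1)
  have h5 := lt_iterExp_of_iterLog_lt _ h4
  rw [iterExp_succ', iterLog_succ, mul_comm, ← Real.rpow_def_of_pos h3] at h5
  exact h5.le

theorem eventually_characteristic_Icc_le_of_pqOrder_lt {n m : ℕ} {f : ℂ → ℂ} {t : ℝ} (ht : 0 ≤ t)
    (h : pqOrder (n + 1) (m + 1) f < (t : EReal)) :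
    ∀ᶠ r in atTop, ∀ x ∈ Set.Icc r (16 * r),
      ValueDistribution.characteristic f ⊤ x ≤ iterExp n ((16 * iterLog m r) ^ t) := by
  obtain ⟨x₀, hx₀⟩ := exists_monotoneOn_iterLog m
  filter_upwards [eventually_forall_ge_atTop.2 (eventually_characteristic_le_of_pqOrder_lt h),
    eventually_iterLog_mul_le m, eventually_ge_atTop x₀,
    eventually_forall_ge_atTop.2 ((tendsto_iterLog_atTop m).eventually_ge_atTop 0)]
    with r h1 h2 h3 h4 x hx
  refine (h1 x hx.1).trans (iterExp_monotone n ?_)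
  refine Real.rpow_le_rpow (h4 x hx.1) (le_trans ?_ h2) ht
  exact hx₀ (h3.trans hx.1) (h3.trans (hx.1.trans hx.2)) hx.2

/-- The case p = q = 1: after division by r^s the left side tends to 0, so t may exceed s by almost
θ. -/
theorem eventually_rpow_mul_rpow_neg_add_lt {a b s t θ : ℝ} (hab : b < a) (hs : 0 < s)
    (hts : t - θ < s) (C : ℝ) :
    ∀ᶠ r : ℝ in atTop, (16 * r) ^ t * r ^ (-θ) + C < a * r ^ s - b * r ^ s := by
  have t1 : Tendsto (fun r : ℝ ↦ 16 ^ t * r ^ (-(s - (t - θ))) + C * r ^ (-s)) atTop (𝓝 0) := by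
    have := ((tendsto_rpow_neg_atTop (sub_pos.2 hts)).const_mul (16 ^ t)).add
      ((tendsto_rpow_neg_atTop hs).const_mul C)
    simpa using this
  filter_upwards [t1.eventually (gt_mem_nhds (sub_pos.2 hab)), eventually_gt_atTop 0] with r h hr
  have hrs : 0 < r ^ s := Real.rpow_pos_of_pos hr s
  have h1 := mul_lt_mul_of_pos_right h hrs
  have e1 : r ^ (-(s - (t - θ))) * r ^ s = r ^ t * r ^ (-θ) := by
    rw [← Real.rpow_add hr, ← Real.rpow_add hr]; congr 1; ring
  have e2 : r ^ (-s) * r ^ s = 1 := by rw [← Real.rpow_add hr]; simp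
  rw [Real.mul_rpow (by norm_num) hr.le]
  calc 16 ^ t * r ^ t * r ^ (-θ) + C
      = (16 ^ t * r ^ (-(s - (t - θ))) + C * r ^ (-s)) * r ^ s := by
        rw [add_mul, mul_assoc, mul_assoc, mul_assoc, e1, e2, mul_one]
    _ < (a - b) * r ^ s := h1
    _ = _ := by ring

/-- With a' midway between b and a, E = exp_{n+1}(a' L^s) bounds each of the three lower terms,
while the top term is at least 4E. The factor r^{-θ} is only used as ≤ 1. -/
theorem eventually_iterExp_rpow_add_lt (n m : ℕ) {a b s t θ : ℝ} (hb : 0 ≤ b) (hab : b < a)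
    (hs : 0 < s) (hts : t < s) (hθ : 0 ≤ θ) (C : ℝ) :
    ∀ᶠ r : ℝ in atTop, iterExp (n + 1) ((16 * iterLog m r) ^ t) * r ^ (-θ) + C <
      iterExp (n + 1) (a * iterLog m r ^ s) - iterExp (n + 1) (b * iterLog m r ^ s) := by
  set a' := (a + b) / 2 with ha'
  have ha'0 : 0 < a' := by linarith
  have hL := tendsto_iterLog_atTop m
  have hLs : Tendsto (fun r ↦ iterLog m r ^ s) atTop atTop := (tendsto_rpow_atTop hs).comp hL
  have h1 : ∀ᶠ x : ℝ in atTop, (16 * x) ^ t ≤ a' * x ^ s := by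
    filter_upwards [eventually_rpow_mul_rpow_neg_add_lt (t := t) (θ := 0) (a := a') (b := 0)
      ha'0 hs (by linarith) 0] with x hx
    simpa using hx.le
  filter_upwards [hL.eventually h1, hLs.eventually_ge_atTop 0,
    (hLs.const_mul_atTop ha'0).eventually_ge_atTop C,
    (hLs.const_mul_atTop (show 0 < a - a' by linarith)).eventually_ge_atTop 2,
    eventually_ge_atTop 1] with r e1 e2 e3 e4 e5
  set L := iterLog m r
  set E := iterExp (n + 1) (a' * L ^ s) with hE
  have hEpos : 0 < E := by rw [hE, iterExp_succ]; exact Real.exp_pos _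
  have i1 : iterExp (n + 1) ((16 * L) ^ t) * r ^ (-θ) ≤ E := by
    have hp : r ^ (-θ) ≤ 1 := Real.rpow_le_one_of_one_le_of_nonpos e5 (by linarith)
    have hp0 : 0 ≤ iterExp (n + 1) ((16 * L) ^ t) := by rw [iterExp_succ]; exact Real.exp_nonneg _
    exact (mul_le_of_le_one_right hp0 hp).trans (iterExp_monotone _ e1)
  have i2 : C ≤ E := e3.trans (le_iterExp _ _)
  have i3 : iterExp (n + 1) (b * L ^ s) ≤ E :=
    iterExp_monotone _ (mul_le_mul_of_nonneg_right (by linarith) e2)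
  have i4 : 4 * E ≤ iterExp (n + 1) (a * L ^ s) := by
    rw [hE, iterExp_succ, iterExp_succ]
    refine four_mul_exp_le_exp (iterExp_add_two_le n (by positivity) ?_)
    linarith
  linarith

/-! ### The contradiction and the choice of δ₀ -/

theorem Meromorphic.meromorphicOrderAt_ne_top_of_not_eventuallyEq_zero {f : ℂ → ℂ}
    (hf : Meromorphic f) (h : ¬ f =ᶠ[codiscrete ℂ] 0) (z : ℂ) : meromorphicOrderAt f z ≠ ⊤ := by
  refine hf.exists_meromorphicOrderAt_ne_top_iff_forall.1 ?_ z
  by_contra! hall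
  apply h
  rw [EventuallyEq, Filter.Eventually, mem_codiscrete]
  intro x
  rw [disjoint_principal_right, compl_compl]
  exact meromorphicOrderAt_eq_top_iff.1 (hall x)

/-- A solution of order below `t` cannot coexist with a dominant coefficient whose growth exceeds
the growth of the shift quotients of the solution. -/
theorem not_dominantOn_of_pqOrder_lt {n m k : ℕ} {c : Fin (k + 1) → ℂ}
    {A : Fin (k + 1) → ℂ → ℂ} {D : Set ℂ} {l : Fin (k + 1)} {a b s t θ : ℝ}
    (hD : 0 < upperLogDensity ((fun z : ℂ ↦ ‖z‖) '' D)) {f : ℂ → ℂ}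
    (hsol : IsDifferenceSolution A c f) (hne : ¬ f =ᶠ[codiscrete ℂ] 0)
    (ht : 0 < t) (hord : pqOrder (n + 1) (m + 1) f < (t : EReal)) (hθ : 0 < θ) (hθ₁ : θ < 1)
    (hgrowth : ∀ C : ℝ, ∀ᶠ r : ℝ in atTop, iterExp n ((16 * iterLog m r) ^ t) * r ^ (-θ) + C <
      iterExp n (a * iterLog m r ^ s) - iterExp n (b * iterLog m r ^ s)) :
    ¬ DominantOn (n + 1) (m + 1) A l D a b s := by
  intro hdom
  obtain ⟨hf, heq⟩ := hsol
  have hf₀ := hf.meromorphicOrderAt_ne_top_of_not_eventuallyEq_zero hne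
  obtain ⟨E, hE, hEz⟩ := hf.exists_logMeasure_lt_top_log_norm_shift_le hf₀ c hθ hθ₁
  have hY1 : ∀ᶠ r in atTop, 1 ≤ iterExp n ((16 * iterLog m r) ^ t) := by
    filter_upwards [(tendsto_iterLog_atTop m).eventually_ge_atTop 1] with r hr
    exact (Real.one_le_rpow (by linarith) ht.le).trans (le_iterExp n _)
  obtain ⟨r₁, hr₁⟩ := eventually_atTop.1 ((eventually_characteristic_Icc_le_of_pqOrder_lt ht.le
    hord).and (hY1.and (hgrowth (Real.log (k + 1)))))
  rw [DominantOn, eventually_inf_principal, ← comap_norm_atTop, eventually_comap] at hdom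
  obtain ⟨r₂, hr₂⟩ := eventually_atTop.1 hdom
  obtain ⟨z, hzD, hzE, hz1, hz2, hzeq⟩ : ∃ z ∈ D, ‖z‖ ∉ E ∧ r₁ ≤ ‖z‖ ∧ r₂ ≤ ‖z‖ ∧
      ∑ j, A j z * f (z + c j) = 0 := by
    -- Otherwise the moduli of D lie in a set of finite logarithmic measure and have density zero.
    by_contra! hcon
    refine hD.ne' (upperLogDensity_eq_zero ?_)
    have hsub : (fun z : ℂ ↦ ‖z‖) '' D ⊆ E ∪ (Set.Iic (max r₁ r₂) ∪
        (fun z : ℂ ↦ ‖z‖) '' {z | ∑ j, A j z * f (z + c j) = 0}ᶜ) := by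
      rintro _ ⟨z, hz, rfl⟩
      by_contra hnot
      simp only [Set.mem_union, not_or, Set.mem_Iic, not_le, max_lt_iff] at hnot
      obtain ⟨g1, ⟨g2, g3⟩, g4⟩ := hnot
      exact g4 ⟨z, hcon z hz g1 g2.le g3.le, rfl⟩
    refine (logMeasure_mono hsub).trans_lt ((logMeasure_union_le _ _).trans_lt
      (ENNReal.add_lt_top.2 ⟨hE, (logMeasure_union_le _ _).trans_lt
        (ENNReal.add_lt_top.2 ⟨logMeasure_Iic_lt_top _, ?_⟩)⟩))
    have hcount : {z | ∑ j, A j z * f (z + c j) = 0}ᶜ.Countable :=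
      countable_compl_of_mem_codiscrete heq
    rw [(hcount.image _).logMeasure_eq_zero]
    exact ENNReal.zero_lt_top
  obtain ⟨hT, hY, hlt⟩ := hr₁ _ hz1
  obtain ⟨hAl, hAj⟩ := hr₂ _ hz2 z rfl hzD
  obtain ⟨hnz, hest⟩ := hEz z hzE
  have hest' := hest _ hY hT
  rw [Nat.add_sub_cancel, iterExp_succ] at hAl
  simp only [Nat.add_sub_cancel, iterExp_succ] at hAj
  set Y := iterExp n ((16 * iterLog m ‖z‖) ^ t) * ‖z‖ ^ (-θ)
  set α := iterExp n (a * iterLog m ‖z‖ ^ s)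
  set γ := iterExp n (b * iterLog m ‖z‖ ^ s)
  have hpos : ∀ j, 0 < ‖f (z + c j)‖ := fun j ↦ norm_pos_iff.2 (hnz j)
  have hratio : ∀ j, ‖f (z + c j)‖ ≤ Real.exp Y * ‖f (z + c l)‖ := fun j ↦ by
    have := hest' j l
    rw [← Real.log_div (hpos j).ne' (hpos l).ne',
      Real.log_le_iff_le_exp (div_pos (hpos j) (hpos l)), div_le_iff₀ (hpos l)] at this
    exact this
  have hsum : A l z * f (z + c l) = -∑ j ∈ Finset.univ.erase l, A j z * f (z + c j) := by
    rw [← Finset.add_sum_erase _ _ (Finset.mem_univ l)] at hzeq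
    exact eq_neg_of_add_eq_zero_left hzeq
  have hle : Real.exp α * ‖f (z + c l)‖ ≤
      (k + 1) * (Real.exp γ * (Real.exp Y * ‖f (z + c l)‖)) := by
    calc Real.exp α * ‖f (z + c l)‖ ≤ ‖A l z‖ * ‖f (z + c l)‖ := by gcongr
      _ = ‖∑ j ∈ Finset.univ.erase l, A j z * f (z + c j)‖ := by rw [← norm_mul, hsum, norm_neg]
      _ ≤ ∑ j ∈ Finset.univ.erase l, Real.exp γ * (Real.exp Y * ‖f (z + c l)‖) := by
          refine norm_sum_le_of_le _ fun j hj ↦ ?_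
          rw [norm_mul]
          gcongr
          · exact hAj j (Finset.ne_of_mem_erase hj)
          · exact hratio j
      -- Restoring the index l gives the factor k + 1, matched by C = log(k + 1) in the growth
      -- hypothesis.
      _ ≤ ∑ _j : Fin (k + 1), Real.exp γ * (Real.exp Y * ‖f (z + c l)‖) :=
          Finset.sum_le_sum_of_subset_of_nonneg (Finset.erase_subset _ _) fun _ _ _ ↦ by positivity
      _ = _ := by simp
  have hlt' : Real.exp (Y + Real.log (k + 1)) < Real.exp (α - γ) := Real.exp_lt_exp.2 hlt
  rw [Real.exp_add, Real.exp_log (by positivity), Real.exp_sub, lt_div_iff₀ (Real.exp_pos _)]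
    at hlt'
  have := mul_lt_mul_of_pos_right hlt' (hpos l)
  linarith

theorem mainTheorem1 (p q : ℕ) (ρ : ℝ) :
    ∃ δ₀ : EReal → ℝ, (∀ σ, 0 < δ₀ σ) ∧
      ∀ (k : ℕ) (c : Fin (k + 1) → ℂ) (A : Fin (k + 1) → ℂ → ℂ) (D : Set ℂ) (l : Fin (k + 1))
        (a b δ : ℝ),
        c 0 = 0 → Function.Injective c →
        0 < upperLogDensity ((fun z : ℂ => ‖z‖) '' D) →
        (∀ j, Differentiable ℂ (A j)) → (∀ j, pqOrder p q (A j) ≤ (ρ : EReal)) →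
        0 ≤ b → b < a → 0 < δ → δ < ρ →
        DominantOn p q A l D a b (ρ - δ) →
        ∀ f : ℂ → ℂ, IsDifferenceSolution A c f → ¬ f =ᶠ[codiscrete ℂ] 0 →
          δ < δ₀ (pqOrder p q f) →
          (p = 1 → q = 1 → pqOrder p q (A l) + 1 ≤ pqOrder p q f) ∧
          (2 ≤ q → q ≤ p → pqOrder p q (A l) ≤ pqOrder p q f) := by
  rcases le_or_gt ρ 0 with hρ | hρ
  · refine ⟨fun _ ↦ 1, fun _ ↦ one_pos, ?_⟩
    intro k c A D l a b δ _ _ _ _ _ _ _ hδ hδρ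
    linarith
  by_cases h11 : p = 1 ∧ q = 1
  · obtain ⟨rfl, rfl⟩ := h11
    -- Choosing t from the order σ of f alone keeps δ₀ = ρ + 1 - t independent of the equation. For
    -- σ ≥ ρ + 1 any such t will do.
    have hex : ∀ σ : EReal, ∃ t : ℝ, 1 < t ∧ t < ρ + 1 ∧ (σ < ((ρ + 1 : ℝ) : EReal) → σ < t) := by
      intro σ
      by_cases hσ : σ < ((ρ + 1 : ℝ) : EReal)
      · have : max σ ((1 : ℝ) : EReal) < ((ρ + 1 : ℝ) : EReal) :=
          max_lt hσ (EReal.coe_lt_coe_iff.2 (by linarith))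
        obtain ⟨t, h1, h2⟩ := EReal.lt_iff_exists_real_btwn.1 this
        exact ⟨t, EReal.coe_lt_coe_iff.1 ((le_max_right _ _).trans_lt h1),
          EReal.coe_lt_coe_iff.1 h2, fun _ ↦ (le_max_left _ _).trans_lt h1⟩
      · exact ⟨1 + ρ / 2, by linarith, by linarith, fun h ↦ absurd h hσ⟩
    choose t ht1 htρ hσt using hex
    refine ⟨fun σ ↦ ρ + 1 - t σ, fun σ ↦ sub_pos.2 (htρ σ), ?_⟩
    intro k c A D l a b δ _ _ hD _ hA _ hba hδ hδρ hdom f hsol hne hδ₀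
    refine ⟨fun _ _ ↦ ?_, fun h ↦ by lia⟩
    by_contra hcon
    have hlt : pqOrder 1 1 f < ((ρ + 1 : ℝ) : EReal) := by
      refine (not_le.1 hcon).trans_le ?_
      rw [EReal.coe_add, EReal.coe_one]
      exact add_le_add_left (hA l) 1
    -- δ < δ₀ says exactly t - (ρ - δ) < 1, leaving room for θ below 1.
    obtain ⟨θ, hθ, hθ₁⟩ := exists_between
      (show max 0 (t (pqOrder 1 1 f) - (ρ - δ)) < 1 from max_lt one_pos (by linarith))
    refine not_dominantOn_of_pqOrder_lt (n := 0) (m := 0) hD hsol hne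
      (by linarith [ht1 (pqOrder 1 1 f)]) (hσt _ hlt) ((le_max_left _ _).trans_lt hθ) hθ₁ ?_ hdom
    exact eventually_rpow_mul_rpow_neg_add_lt hba (by linarith)
      (by linarith [(le_max_right _ _).trans_lt hθ])
  by_cases hpq : 2 ≤ q ∧ q ≤ p
  · obtain ⟨hq, hqp⟩ := hpq
    obtain ⟨n, rfl⟩ : ∃ n, p = n + 1 + 1 := ⟨p - 2, by lia⟩
    obtain ⟨m, rfl⟩ : ∃ m, q = m + 1 := ⟨q - 1, by lia⟩
    have hex : ∀ σ : EReal, ∃ t : ℝ, 0 < t ∧ t < ρ ∧ (σ < (ρ : EReal) → σ < t) := by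
      intro σ
      by_cases hσ : σ < (ρ : EReal)
      · have : max σ ((0 : ℝ) : EReal) < (ρ : EReal) := max_lt hσ (EReal.coe_lt_coe_iff.2 hρ)
        obtain ⟨t, h1, h2⟩ := EReal.lt_iff_exists_real_btwn.1 this
        exact ⟨t, EReal.coe_lt_coe_iff.1 ((le_max_right _ _).trans_lt h1),
          EReal.coe_lt_coe_iff.1 h2, fun _ ↦ (le_max_left _ _).trans_lt h1⟩
      · exact ⟨ρ / 2, by linarith, by linarith, fun h ↦ absurd h hσ⟩
    choose t ht0 htρ hσt using hex
    refine ⟨fun σ ↦ ρ - t σ, fun σ ↦ sub_pos.2 (htρ σ), ?_⟩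
    intro k c A D l a b δ _ _ hD _ hA hb hba hδ hδρ hdom f hsol hne hδ₀
    refine ⟨fun h ↦ by lia, fun _ _ ↦ ?_⟩
    by_contra hcon
    have hlt := (not_le.1 hcon).trans_le (hA l)
    -- Any θ in (0, 1) serves, since δ < δ₀ = ρ - t already gives t < ρ - δ.
    refine not_dominantOn_of_pqOrder_lt (θ := 1 / 2) hD hsol hne (ht0 _) (hσt _ hlt)
      (by norm_num) (by norm_num) ?_ hdom
    exact eventually_iterExp_rpow_add_lt n m hb hba (by linarith) (by linarith) (by norm_num)
  · refine ⟨fun _ ↦ 1, fun _ ↦ one_pos, ?_⟩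
    intro k c A D l a b δ _ _ _ _ _ _ _ _ _ _ f _ _ _
    exact ⟨fun hp hq ↦ absurd ⟨hp, hq⟩ h11, fun hq hp ↦ absurd ⟨hq, hp⟩ hpq⟩
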